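/- Let $(B,g_B)$ and $(F,g_F)$ be smooth Riemannian manifolds without boundary, of dimensions $d$ and $n$, let $f:B\to(0,\infty)$ and $\Psi:F\to\mathbb R$ be smooth, and let $N\ge 1$ be a real number. Let $C=B\times_f F$ be the product manifold $B\times F$ with the warped product metric $g_C=\pi_B^*g_B+(f\circ\pi_B)^2\,\pi_F^*g_F$, and put $\Phi=-(N-n)\log f$. (Thus the reference measure $f^N\,d\mathrm{vol}_B\otimes e^{-\Psi}d\mathrm{vol}_F$ of the $N$-warped product is $e^{-(\Phi+\Psi)}d\mathrm{vol}_C$; here $\Phi$ and $\Psi$ are regarded as functions on $B\times F$.) For a bilinear form $b$ write $b(v)=b(v,v)$. For an $m$-dimensional Riemannian manifold $(M,g)$ and a smooth $\Theta:M\to\mathbb R$, the Bakry–Émery $N$-Ricci tensor is defined, for $v\in T_pM$, by $$\mathrm{Ric}^{N,\Theta}_M(v)=\begin{cases}\mathrm{Ric}_M(v)+\nabla^2\Theta(v)-\frac1{N-m}\,(d\Theta(v))^2,& N>m,\\ \mathrm{Ric}_M(v)+\nabla^2\Theta(v),& N=m,\ d\Theta(v)=0,\\ -\infty,& N=m,\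 d\Theta(v)\ne0,\\ 0,& N<m,\ v=0,\\ -\infty,& N<m,\ v\neq 0.\end{cases}$$ Let $p\in B$, $x\in F$, $\xi\in T_pB$, $v\in T_xF$; identify $T_{(p,x)}C=T_pB\oplus T_xF$ and let $\tilde V=0+v\in T_{(p,x)}C$ be the vertical lift of $v$, so that $|\tilde V|^2=g_C(\tilde V,\tilde V)=f(p)^2\,g_F(v,v)$. (i) If $N\ge n$, or $v\neq0$, or $\xi=0$, then in $[-\infty,\infty)$ $$\mathrm{Ric}_C^{N+d,\Phi+\Psi}(\xi+v)=\mathrm{Ric}_B(\xi)-N\frac{\nabla^2f(\xi)}{f(p)}+\mathrm{Ric}^{N,\Psi}_F(v)-\left(\frac{\Delta f(p)}{f(p)}+(N-1)\frac{|\nabla f(p)|^2}{f(p)^2}\right)|\tilde V|^2 .$$ (ii) If $\Psi=0$ and $N\ge n$, then $\mathrm{Ric}^{N,0}_F(v)=\mathrm{Ric}_F(v)$ and $$\mathrm{Ric}_C^{N+d,\Phi}(\xi+v)=\mathrm{Ric}_B(\xi)-N\frac{\nabla^2f(\xi)}{f(p)}+\mathrm{Ric}_F(v)-\left(\frac{\Delta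 f(p)}{f(p)}+(N-1)\frac{|\nabla f(p)|^2}{f(p)^2}\right)|\tilde V|^2 .$$ Here $\nabla^2f$ is the Hessian, $\Delta f=\mathrm{tr}\,\nabla^2 f$ the Laplacian and $\nabla f$ the gradient with respect to $g_B$. -/

import Mathlib

open scoped Manifold ContDiff Topology

set_option maxSynthPendingDepth 3

noncomputable section

namespace WarpedRicci

/-! ### Riemannian geometry in coordinates

`G : E → E →L[ℝ] E →L[ℝ] ℝ` is the field of coefficients `y ↦ (g_{ij}(y))` of a metric, written in a
coordinate chart with values in the finite-dimensional space `E`. -/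

section Coordinates

variable {E : Type*} [NormedAddCommGroup E] [NormedSpace ℝ E]

/-- Christoffel symbols of the first kind (Koszul formula for constant coordinate fields):
`Γ_{u v, w} = ½ (∂_u G(v, w) + ∂_v G(u, w) - ∂_w G(u, v))`. -/
def christoffelFirst (G : E → E →L[ℝ] E →L[ℝ] ℝ) (y : E) : E →L[ℝ] E →L[ℝ] E →L[ℝ] ℝ :=
  (1 / 2 : ℝ) • (fderiv ℝ G y + (fderiv ℝ G y).flip
    - (ContinuousLinearMap.flipₗᵢ ℝ E E ℝ : (E →L[ℝ] E →L[ℝ] ℝ) →L[ℝ] E →L[ℝ] E →L[ℝ] ℝ) ∘L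
        (fderiv ℝ G y).flip)

theorem christoffelFirst_apply (G : E → E →L[ℝ] E →L[ℝ] ℝ) (y u v w : E) :
    christoffelFirst G y u v w =
      1 / 2 * (fderiv ℝ G y u v w + fderiv ℝ G y v u w - fderiv ℝ G y w u v) := rfl

/-- The Levi-Civita connection in coordinates: `christoffel G y u v = ∇_u v` at `y` for constant
coordinate fields `u`, `v`, that is, `G y (christoffel G y u v) = christoffelFirst G y u v`. -/
def christoffel (G : E → E →L[ℝ] E →L[ℝ] ℝ) (y : E) : E →L[ℝ] E →L[ℝ] E :=
  ContinuousLinearMap.compL ℝ E (E →L[ℝ] ℝ) E (G y).inverse ∘L christoffelFirst G y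

theorem christoffel_apply (G : E → E →L[ℝ] E →L[ℝ] ℝ) (y u v : E) :
    christoffel G y u v = (G y).inverse (christoffelFirst G y u v) := rfl

/-- The endomorphism `u ↦ R(u, v) w`, where `R(u, v) w = ∇_u ∇_v w - ∇_v ∇_u w` for constant
coordinate fields `u`, `v`, `w`. -/
def curvatureEndo (G : E → E →L[ℝ] E →L[ℝ] ℝ) (y v w : E) : E →L[ℝ] E :=
  ((fderiv ℝ (christoffel G) y).flip v).flip w - (fderiv ℝ (christoffel G) y v).flip w
    + (christoffel G y).flip (christoffel G y v w)
    - christoffel G y v ∘L (christoffel G y).flip w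

theorem curvatureEndo_apply (G : E → E →L[ℝ] E →L[ℝ] ℝ) (y u v w : E) :
    curvatureEndo G y v w u =
      fderiv ℝ (christoffel G) y u v w - fderiv ℝ (christoffel G) y v u w
        + christoffel G y u (christoffel G y v w) - christoffel G y v (christoffel G y u w) := rfl

/-- The Ricci tensor `Ric(v, w) = tr (u ↦ R(u, v) w)` in coordinates. -/
def ricciCoord (G : E → E →L[ℝ] E →L[ℝ] ℝ) (y v w : E) : ℝ :=
  LinearMap.trace ℝ E (curvatureEndo G y v w : E →ₗ[ℝ] E)

/-- The Hessian of a function in coordinates. -/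
def hessianCoord (G : E → E →L[ℝ] E →L[ℝ] ℝ) (h : E → ℝ) (y : E) : E →L[ℝ] E →L[ℝ] ℝ :=
  fderiv ℝ (fderiv ℝ h) y
    - ContinuousLinearMap.compL ℝ E E ℝ (fderiv ℝ h y) ∘L christoffel G y

theorem hessianCoord_apply (G : E → E →L[ℝ] E →L[ℝ] ℝ) (h : E → ℝ) (y u v : E) :
    hessianCoord G h y u v =
      fderiv ℝ (fderiv ℝ h) y u v - fderiv ℝ h y (christoffel G y u v) := rfl

/-- The Laplacian of a function in coordinates: the metric trace of the Hessian. -/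
def laplacianCoord (G : E → E →L[ℝ] E →L[ℝ] ℝ) (h : E → ℝ) (y : E) : ℝ :=
  LinearMap.trace ℝ E ((G y).inverse ∘L hessianCoord G h y : E →L[ℝ] E)

end Coordinates

/-! ### Riemannian manifolds -/

/-- The pullback of a bilinear form under a linear map: `(u, v) ↦ h (T u) (T v)`. -/
def pullbackForm {V W : Type*} [AddCommGroup V] [Module ℝ V] [TopologicalSpace V]
    [IsTopologicalAddGroup V] [ContinuousSMul ℝ V]
    [AddCommGroup W] [Module ℝ W] [TopologicalSpace W]
    [IsTopologicalAddGroup W] [ContinuousSMul ℝ W]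
    (h : V →L[ℝ] V →L[ℝ] ℝ) (T : W →L[ℝ] V) : W →L[ℝ] W →L[ℝ] ℝ :=
  (ContinuousLinearMap.precomp ℝ T ∘L h) ∘L T

theorem pullbackForm_apply {V W : Type*} [AddCommGroup V] [Module ℝ V] [TopologicalSpace V]
    [IsTopologicalAddGroup V] [ContinuousSMul ℝ V]
    [AddCommGroup W] [Module ℝ W] [TopologicalSpace W]
    [IsTopologicalAddGroup W] [ContinuousSMul ℝ W]
    (h : V →L[ℝ] V →L[ℝ] ℝ) (T : W →L[ℝ] V) (u v : W) :
    pullbackForm h T u v = h (T u) (T v) := rfl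

/-- Smooth Riemannian metrics on the manifold `M`. -/
abbrev RiemMetric {E : Type*} [NormedAddCommGroup E] [NormedSpace ℝ E] {H : Type*} [TopologicalSpace H]
    (I : ModelWithCorners ℝ E H) (M : Type*) [TopologicalSpace M] [ChartedSpace H M]
    [IsManifold I ∞ M] : Type _ :=
  Bundle.ContMDiffRiemannianMetric I ∞ E (fun x : M ↦ TangentSpace I x)

section Manifold

variable {E : Type*} [NormedAddCommGroup E] [NormedSpace ℝ E]
  {H : Type*} [TopologicalSpace H] {I : ModelWithCorners ℝ E H}
  {M : Type*} [TopologicalSpace M] [ChartedSpace H M] [IsManifold I ∞ M]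

/-- The metric `g` read in the preferred chart `φ` at `p`, that is, `(φ⁻¹)^* g`. -/
def metricInChart (g : RiemMetric I M) (p : M) (y : E) : E →L[ℝ] E →L[ℝ] ℝ :=
  pullbackForm (g.inner ((extChartAt I p).symm y))
    (mfderiv 𝓘(ℝ, E) I (extChartAt I p).symm y ∘L
      (NormedSpace.fromTangentSpace (𝕜 := ℝ) y).symm.toContinuousLinearMap)

theorem metricInChart_apply (g : RiemMetric I M) (p : M) (y u v : E) :
    metricInChart g p y u v =
      g.inner ((extChartAt I p).symm y)
        (mfderiv 𝓘(ℝ, E) I (extChartAt I p).symm y ((NormedSpace.fromTangentSpace (𝕜 := ℝ) y).symm u))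
        (mfderiv 𝓘(ℝ, E) I (extChartAt I p).symm y ((NormedSpace.fromTangentSpace (𝕜 := ℝ) y).symm v)) := rfl

/-! Mathlib's tangent space at `p` is the model space `E`, a vector being represented by its
coordinates in the preferred chart at `p`. The tensors below are therefore evaluated at `p` on the
coordinates of the vectors. -/

/-- The Ricci curvature `Ric(v) = Ric(v, v)`. -/
def ricci (g : RiemMetric I M) (p : M) (v : TangentSpace I p) : ℝ :=
  ricciCoord (metricInChart g p) (extChartAt I p p) v v

/-- The Hessian `∇²h(v) = ∇²h(v, v)` of a function. -/
def hessian (g : RiemMetric I M) (h : M → ℝ) (p : M) (v : TangentSpace I p) : ℝ :=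
  hessianCoord (metricInChart g p) (h ∘ (extChartAt I p).symm) (extChartAt I p p) v v

/-- The Laplacian `Δh = tr ∇²h` of a function. -/
def laplacian (g : RiemMetric I M) (h : M → ℝ) (p : M) : ℝ :=
  laplacianCoord (metricInChart g p) (h ∘ (extChartAt I p).symm) (extChartAt I p p)

/-- The squared norm `|v|² = g(v, v)`. -/
def normSq (g : RiemMetric I M) (p : M) (v : TangentSpace I p) : ℝ := g.inner p v v

/-- The gradient of a function: the vector with `g(∇h, ·) = dh`. -/
def metricGradient (g : RiemMetric I M) (h : M → ℝ) (p : M) : TangentSpace I p :=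
  (g.inner p).inverse (mvfderiv I h p)

open Classical in
/-- The Bakry–Émery `N`-Ricci tensor `Ric^{N,Ψ}(v)` of the manifold weighted by `e^{-Ψ} dvol`, with
values in `[-∞, ∞]`; here `Module.finrank ℝ E` is the dimension of `M`. -/
def weightedRicci (N : ℝ) (g : RiemMetric I M) (Ψ : M → ℝ) (p : M) (v : TangentSpace I p) : EReal :=
  if (Module.finrank ℝ E : ℝ) < N then
    ((ricci g p v + hessian g Ψ p v
      - 1 / (N - Module.finrank ℝ E) * (mvfderiv I Ψ p v) ^ 2 : ℝ) : EReal)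
  else if N = Module.finrank ℝ E then
    if mvfderiv I Ψ p v = 0 then ((ricci g p v + hessian g Ψ p v : ℝ) : EReal) else ⊥
  else if v = 0 then 0 else ⊥

end Manifold

/-! ### Warped products -/

section Warped

variable {EB : Type*} [NormedAddCommGroup EB] [NormedSpace ℝ EB]
  {HB : Type*} [TopologicalSpace HB] {IB : ModelWithCorners ℝ EB HB}
  {B : Type*} [TopologicalSpace B] [ChartedSpace HB B] [IsManifold IB ∞ B]
  {EF : Type*} [NormedAddCommGroup EF] [NormedSpace ℝ EF]
  {HF : Type*} [TopologicalSpace HF] {IF : ModelWithCorners ℝ EF HF}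
  {F : Type*} [TopologicalSpace F] [ChartedSpace HF F] [IsManifold IF ∞ F]

/-- The bilinear form of the warped product metric `π_B^* g_B + (f ∘ π_B)² π_F^* g_F`. -/
def warpedForm (gB : RiemMetric IB B) (gF : RiemMetric IF F) (f : B → ℝ) (z : B × F) :
    TangentSpace (IB.prod IF) z →L[ℝ] TangentSpace (IB.prod IF) z →L[ℝ] ℝ :=
  pullbackForm (gB.inner z.1) (mfderiv (IB.prod IF) IB Prod.fst z)
    + (f z.1) ^ 2 • pullbackForm (gF.inner z.2) (mfderiv (IB.prod IF) IF Prod.snd z)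

theorem inCoordinates_form {E : Type*} [NormedAddCommGroup E] [NormedSpace ℝ E]
    {H : Type*} [TopologicalSpace H] {I : ModelWithCorners ℝ E H}
    {M : Type*} [TopologicalSpace M] [ChartedSpace H M] [IsManifold I ∞ M] (x₀ x : M)
    (h : TangentSpace I x →L[ℝ] TangentSpace I x →L[ℝ] ℝ) (hx : x ∈ (chartAt H x₀).source) :
    ContinuousLinearMap.inCoordinates E (fun x : M ↦ TangentSpace I x) (E →L[ℝ] ℝ)
      (fun x : M ↦ TangentSpace I x →L[ℝ] ℝ) x₀ x x₀ x h =
    pullbackForm h ((trivializationAt E (TangentSpace I) x₀).symmL ℝ x) := by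
  ext u v
  rw [ContinuousLinearMap.inCoordinates_eq (by simpa using hx) (by simp [hom_trivializationAt_baseSet, hx])]
  simp [pullbackForm_apply]
  have hb : x ∈ (trivializationAt E (TangentSpace I : M → Type _) x₀).baseSet := by simpa using hx
  rw [hom_trivializationAt_apply]
  simp only [ContinuousLinearMap.inCoordinates]
  rw [Bundle.Trivialization.symmL_apply _ hb, Bundle.Trivialization.symmL_apply _ hb]
  simp only [ContinuousLinearMap.coe_comp, Function.comp_apply, 
    Bundle.Trivial.fiberBundle_trivializationAt', Bundle.Trivial.continuousLinearMapAt_trivialization]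
  rw [Bundle.Trivialization.symmL_apply _ hb]
  rfl

theorem contMDiff_pullback {E : Type*} [NormedAddCommGroup E] [NormedSpace ℝ E]
    {H : Type*} [TopologicalSpace H] {I : ModelWithCorners ℝ E H}
    {M : Type*} [TopologicalSpace M] [ChartedSpace H M] [IsManifold I ∞ M]
    (g : RiemMetric IB B) {b : M → B} (hb : ContMDiff I IB ∞ b) :
    ContMDiff I (I.prod 𝓘(ℝ, E →L[ℝ] E →L[ℝ] ℝ)) ∞
      (fun x : M ↦ Bundle.TotalSpace.mk' (E →L[ℝ] E →L[ℝ] ℝ)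
        (E := fun x : M ↦ TangentSpace I x →L[ℝ] TangentSpace I x →L[ℝ] ℝ) x
        (pullbackForm (g.inner (b x)) (mfderiv I IB b x))) := by
  intro x₀
  have h1 : ContMDiffAt I 𝓘(ℝ, E →L[ℝ] EB) ∞
      (inTangentCoordinates I IB id b (mfderiv I IB b) x₀) x₀ :=
    (hb x₀).mfderiv_const (by simp)
  have h2 := (g.contMDiff (b x₀)).comp x₀ (hb x₀)
  rw [contMDiffAt_hom_bundle] at h2 ⊢
  refine ⟨contMDiffAt_id, ?_⟩
  have h3 := h2.2
  have h4 : ContMDiffAt I 𝓘(ℝ, E →L[ℝ] E →L[ℝ] ℝ) ∞ (fun x ↦ 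
     (ContinuousLinearMap.inCoordinates EB (fun x : B ↦ TangentSpace IB x) (EB →L[ℝ] ℝ)
      (fun x : B ↦ TangentSpace IB x →L[ℝ] ℝ) (b x₀) (b x) (b x₀) (b x) (g.inner (b x))).bilinearComp 
      (inTangentCoordinates I IB id b (mfderiv I IB b) x₀ x) 
      (inTangentCoordinates I IB id b (mfderiv I IB b) x₀ x)) x₀ := by
    have hf : ContMDiff 𝓘(ℝ, E →L[ℝ] EB →L[ℝ] ℝ) 𝓘(ℝ, EB →L[ℝ] E →L[ℝ] ℝ) ∞
        (fun L : E →L[ℝ] EB →L[ℝ] ℝ ↦ L.flip) :=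
      (ContinuousLinearMap.flipₗᵢ ℝ E EB ℝ).contDiff.contMDiff
    have hf' : ContMDiff 𝓘(ℝ, E →L[ℝ] E →L[ℝ] ℝ) 𝓘(ℝ, E →L[ℝ] E →L[ℝ] ℝ) ∞
        (fun L : E →L[ℝ] E →L[ℝ] ℝ ↦ L.flip) :=
      (ContinuousLinearMap.flipₗᵢ ℝ E E ℝ).contDiff.contMDiff
    exact (hf' _).comp x₀ (((hf _).comp x₀ (h3.clm_comp h1)).clm_comp h1)
  refine h4.congr_of_eventuallyEq ?_
  have e1 : ∀ᶠ x in 𝓝 x₀, x ∈ (chartAt H x₀).source := chart_source_mem_nhds H x₀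
  have e2 : ∀ᶠ x in 𝓝 x₀, b x ∈ (chartAt HB (b x₀)).source :=
    (hb x₀).continuousAt (chart_source_mem_nhds HB (b x₀))
  filter_upwards [e1, e2] with x hx hbx
  ext u v
  rw [inCoordinates_form _ _ _ hx, inCoordinates_form _ _ _ hbx]
  simp only [pullbackForm_apply, ContinuousLinearMap.bilinearComp_apply, inTangentCoordinates, ContinuousLinearMap.inCoordinates, ContinuousLinearMap.comp_apply]
  have hb' : b x ∈ (trivializationAt EB (TangentSpace IB : B → Type _) (b x₀)).baseSet := by
    simpa using hbx
  erw [Bundle.Trivialization.symmL_continuousLinearMapAt _ hb',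
    Bundle.Trivialization.symmL_continuousLinearMapAt _ hb']
  rfl

theorem warpedForm_apply (gB : RiemMetric IB B) (gF : RiemMetric IF F) (f : B → ℝ) (z : B × F)
    (u v : TangentSpace (IB.prod IF) z) :
    warpedForm gB gF f z u v =
      gB.inner z.1 (mfderiv (IB.prod IF) IB Prod.fst z u) (mfderiv (IB.prod IF) IB Prod.fst z v)
      + (f z.1) ^ 2 *
        gF.inner z.2 (mfderiv (IB.prod IF) IF Prod.snd z u)
          (mfderiv (IB.prod IF) IF Prod.snd z v) := rfl

/-- The horizontal lift of `ξ ∈ T_p B` to `T_{(p,x)}(B × F)`. -/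
def horizontalLift (p : B) (x : F) (ξ : TangentSpace IB p) : TangentSpace (IB.prod IF) (p, x) :=
  mfderiv IB (IB.prod IF) (fun q : B ↦ (q, x)) p ξ

/-- The vertical lift of `v ∈ T_x F` to `T_{(p,x)}(B × F)`. -/
def verticalLift (p : B) (x : F) (v : TangentSpace IF x) : TangentSpace (IB.prod IF) (p, x) :=
  mfderiv IF (IB.prod IF) (fun y : F ↦ (p, y)) x v

theorem lift_add_lift (z : B × F) (v : TangentSpace (IB.prod IF) z) :
    horizontalLift z.1 z.2 (mfderiv (IB.prod IF) IB Prod.fst z v)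
      + verticalLift z.1 z.2 (mfderiv (IB.prod IF) IF Prod.snd z v) = v := by
  rw [horizontalLift, verticalLift, mfderiv_prod_left, mfderiv_prod_right, mfderiv_fst, mfderiv_snd]
  exact Prod.fst_add_snd (M := EB) (N := EF) v

theorem metric_self_nonneg (g : RiemMetric IB B) (p : B) (v : TangentSpace IB p) :
    0 ≤ g.inner p v v := by
  by_cases h : v = 0
  · simp [h]
  · exact (g.pos p v h).le

/-- The Riemannian warped product metric on `B × F`. -/
def warpedMetric (gB : RiemMetric IB B) (gF : RiemMetric IF F) (f : B → ℝ)
    (hf : ContMDiff IB 𝓘(ℝ, ℝ) ∞ f) (hpos : ∀ p, 0 < f p) : RiemMetric (IB.prod IF) (B × F) where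
  inner := warpedForm gB gF f
  symm z u v := by
    rw [warpedForm_apply, warpedForm_apply, gB.symm, gF.symm]
  pos z v hv := by
    have hB := metric_self_nonneg gB z.1 (mfderiv (IB.prod IF) IB Prod.fst z v)
    have hF := metric_self_nonneg gF z.2 (mfderiv (IB.prod IF) IF Prod.snd z v)
    have hf2 : 0 < (f z.1) ^ 2 := pow_pos (hpos z.1) 2
    rw [warpedForm_apply]
    by_cases h : mfderiv (IB.prod IF) IF Prod.snd z v = 0
    · have h' : mfderiv (IB.prod IF) IB Prod.fst z v ≠ 0 := by
        intro h'
        apply hv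
        rw [← lift_add_lift z v, h, h']
        simp [horizontalLift, verticalLift]
      have := gB.pos z.1 _ h'
      positivity
    · have := gF.pos z.2 _ h
      positivity
  isVonNBounded z := by
    have hf0 : 0 < f z.1 := hpos z.1
    have hb1 := (gB.isVonNBounded z.1).image
      (mfderiv IB (IB.prod IF) (fun q : B ↦ (q, z.2)) z.1)
    have hb2 := (gF.isVonNBounded z.2).image
      ((f z.1)⁻¹ • mfderiv IF (IB.prod IF) (fun y : F ↦ (z.1, y)) z.2)
    refine (hb1.add hb2).subset fun v hv ↦ ?_
    have hB := metric_self_nonneg gB z.1 (mfderiv (IB.prod IF) IB Prod.fst z v)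
    have hF := metric_self_nonneg gF z.2 (mfderiv (IB.prod IF) IF Prod.snd z v)
    have hlt : warpedForm gB gF f z v v < 1 := hv
    rw [warpedForm_apply] at hlt
    refine Set.mem_add.2 ⟨_, ⟨mfderiv (IB.prod IF) IB Prod.fst z v, ?_, rfl⟩, _,
      ⟨f z.1 • mfderiv (IB.prod IF) IF Prod.snd z v, ?_, rfl⟩, ?_⟩
    · have : 0 ≤ (f z.1) ^ 2 * gF.inner z.2 (mfderiv (IB.prod IF) IF Prod.snd z v)
          (mfderiv (IB.prod IF) IF Prod.snd z v) := by positivity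
      change gB.inner z.1 _ _ < 1
      linarith
    · change gF.inner z.2 _ _ < 1
      simp only [map_smul, smul_apply, smul_eq_mul]
      nlinarith
    · rw [smul_apply, map_smul, smul_smul, inv_mul_cancel₀ hf0.ne', one_smul]
      exact lift_add_lift z v
  contMDiff := by
    have h1 := contMDiff_pullback gB (contMDiff_fst (I := IB) (J := IF) (n := ∞) (M := B) (N := F))
    have h2 := contMDiff_pullback gF (contMDiff_snd (I := IB) (J := IF) (n := ∞) (M := B) (N := F))
    have h3 : ContMDiff (IB.prod IF) 𝓘(ℝ, ℝ) ∞ (fun z : B × F ↦ (f z.1) ^ 2) :=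
      (hf.comp contMDiff_fst).pow 2
    exact h1.add_section (h3.smul_section h2)

/-- The weight `Φ = -(N - n) log f` on the base; `n = Module.finrank ℝ EF` is the dimension of the
fibre. Thus `e^{-Φ} = f^{N-n}`. -/
def warpWeight (EF : Type*) [NormedAddCommGroup EF] [NormedSpace ℝ EF] {B : Type*}
    (N : ℝ) (f : B → ℝ) (p : B) : ℝ :=
  -(N - Module.finrank ℝ EF) * Real.log (f p)

/-- The weight `Φ + Ψ` on the product `B × F`: the reference measure
`f^N dvol_B ⊗ e^{-Ψ} dvol_F` of the `N`-warped product is `e^{-(Φ+Ψ)}` times the Riemannian volume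
`f^n dvol_B ⊗ dvol_F` of the warped product metric. -/
def totalWeight (EF : Type*) [NormedAddCommGroup EF] [NormedSpace ℝ EF] {B F : Type*}
    (N : ℝ) (f : B → ℝ) (Ψ : F → ℝ) (z : B × F) : ℝ :=
  warpWeight EF N f z.1 + Ψ z.2

end Warped

end WarpedRicci

end

open WarpedRicci

/-! Everything is computed at the base point in the product of the preferred charts. There the
warped metric has block coefficients `GB ⊕ φ² GF`, where `φ` is `f` in the chart. Its Christoffel
symbols follow from the Koszul formula (`christoffel_warpedCoord`); differentiating them gives the
curvature. The Ricci tensor is a trace over base and fibre directions, so only two diagonal blocks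
are needed. The base block (`curvatureEndo_warpedCoord_base`) gives `Ric_B` and the Laplacian term;
the fibre block (`curvatureEndo_warpedCoord_fibre`) gives `Ric_F`, `n` copies of the Hessian term
and `n - 1` copies of the gradient term. This is the stated formula with the true dimension `n` in
place of `N`. The weight makes up the difference. The Hessian of `-(N - n) log f` with respect to
the warped metric adds `N - n` more copies of both terms (`hessianCoord_warpedCoord`,
`hessianCoord_const_mul_log`), along with terms in `s = df(ξ)/f`. For `N > n` these are absorbed by
the quadratic term of the Bakry–Émery tensor: `(N-n) s² - 2 s dΨ(v) - (-(N-n) s + dΨ(v))²/(N-n) =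
-dΨ(v)²/(N-n)`. For `N = n` the weight is `Ψ` alone. For `N < n` both sides are `-∞` unless the
vectors vanish. -/

noncomputable section

namespace WarpedRicci

/-! ### Levi-Civita calculus for a metric given by its coefficients. -/

section Coordinates

variable {E : Type*} [NormedAddCommGroup E] [NormedSpace ℝ E]

/-- A nondegenerate bilinear form on a finite-dimensional space is invertible. -/
theorem isInvertible_of_nondegenerate [FiniteDimensional ℝ E] {A : E →L[ℝ] E →L[ℝ] ℝ}
    (h : ∀ u, A u = 0 → u = 0) :
    A.IsInvertible := by
  have hinj : Function.Injective (A : E →ₗ[ℝ] E →L[ℝ] ℝ) :=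
    (injective_iff_map_eq_zero (A : E →ₗ[ℝ] E →L[ℝ] ℝ)).2 h
  have hdim : Module.finrank ℝ E = Module.finrank ℝ (E →L[ℝ] ℝ) :=
    ((LinearMap.toContinuousLinearMap (𝕜 := ℝ) (E := E) (F' := ℝ)).finrank_eq.symm.trans
      (Subspace.dual_finrank_eq (K := ℝ) (V := E))).symm
  exact ⟨(LinearEquiv.ofInjectiveOfFinrankEq (A : E →ₗ[ℝ] E →L[ℝ] ℝ) hinj hdim).toContinuousLinearEquiv,
    by ext u v; rfl⟩

/-- Isomorphisms form an open set. Identities involving the inverse metric thus hold near the point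
and may be differentiated there. -/
theorem eventually_isInvertible [FiniteDimensional ℝ E] {X : Type*} [TopologicalSpace X]
    {G : X → E →L[ℝ] E →L[ℝ] ℝ} {y : X}
    (hG : ContinuousAt G y) (hy : (G y).IsInvertible) : ∀ᶠ z in 𝓝 y, (G z).IsInvertible := by
  obtain ⟨e, he⟩ := hy
  have := hG (he ▸ ContinuousLinearEquiv.nhds e)
  filter_upwards [this] with z hz
  obtain ⟨e', he'⟩ := hz
  exact ⟨e', he'⟩

variable {G : E → E →L[ℝ] E →L[ℝ] ℝ} {y : E}

theorem contDiffAt_inverse [FiniteDimensional ℝ E] {n : WithTop ℕ∞}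
    (hG : ContDiffAt ℝ n G y) (hy : (G y).IsInvertible) :
    ContDiffAt ℝ n (fun z ↦ (G z).inverse) y := by
  have : CompleteSpace E := FiniteDimensional.complete ℝ E
  exact (hy.contDiffAt_map_inverse).comp y hG

theorem contDiffAt_christoffelFirst (hG : ContDiffAt ℝ 2 G y) :
    ContDiffAt ℝ 1 (christoffelFirst G) y := by
  have h1 : ContDiffAt ℝ 1 (fderiv ℝ G) y := hG.fderiv_right (by norm_num)
  have h2 : ContDiffAt ℝ 1 (fun z ↦ (fderiv ℝ G z).flip) y :=
    ((ContinuousLinearMap.flipₗᵢ ℝ E E (E →L[ℝ] ℝ)).contDiff.contDiffAt).comp y h1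
  exact ((h1.add h2).sub (contDiffAt_const.clm_comp h2)).const_smul (1 / 2 : ℝ)

theorem contDiffAt_christoffel [FiniteDimensional ℝ E] (hG : ContDiffAt ℝ 2 G y)
    (hy : (G y).IsInvertible) :
    ContDiffAt ℝ 1 (christoffel G) y := by
  have h1 := contDiffAt_inverse (hG.of_le (by norm_num : (1 : WithTop ℕ∞) ≤ 2)) hy
  have h2 : ContDiffAt ℝ 1
      (fun z ↦ ContinuousLinearMap.compL ℝ E (E →L[ℝ] ℝ) E (G z).inverse) y :=
    ((ContinuousLinearMap.compL ℝ E (E →L[ℝ] ℝ) E).contDiff.contDiffAt).comp y h1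
  exact h2.clm_comp (contDiffAt_christoffelFirst hG)

theorem metric_christoffel (hy : (G y).IsInvertible) (u v w : E) :
    G y (christoffel G y u v) w = christoffelFirst G y u v w := by
  rw [christoffel_apply, hy.self_apply_inverse]

theorem fderiv_metric_symm (hs : ∀ z u v, G z u v = G z v u) (hG : DifferentiableAt ℝ G y)
    (t u v : E) : fderiv ℝ G y t u v = fderiv ℝ G y t v u := by
  have h (a b : E) : HasFDerivAt (fun z ↦ G z a b) (((fderiv ℝ G y).flip a).flip b) y := by
    have := (hG.hasFDerivAt.clm_apply (hasFDerivAt_const a y)).clm_apply (hasFDerivAt_const b y)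
    refine this.congr_fderiv ?_
    ext; simp
  have e : (fun z ↦ G z u v) = fun z ↦ G z v u := funext fun z ↦ hs z u v
  exact congrArg (fun L : E →L[ℝ] ℝ ↦ L t) ((h u v).unique (e ▸ h v u))

theorem christoffel_symm (hs : ∀ z u v, G z u v = G z v u) (hG : DifferentiableAt ℝ G y)
    (u v : E) : christoffel G y u v = christoffel G y v u := by
  rw [christoffel_apply, christoffel_apply]
  congr 1
  ext w
  rw [christoffelFirst_apply, christoffelFirst_apply, fderiv_metric_symm hs hG w u v]
  ring

/-- The Levi-Civita connection is compatible with the metric. -/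
theorem fderiv_metric (hs : ∀ z u v, G z u v = G z v u) (hG : DifferentiableAt ℝ G y)
    (hy : (G y).IsInvertible) (u v w : E) :
    fderiv ℝ G y u v w = G y (christoffel G y u v) w + G y v (christoffel G y u w) := by
  rw [hs y v, metric_christoffel hy, metric_christoffel hy, christoffelFirst_apply,
    christoffelFirst_apply, fderiv_metric_symm hs hG u w v, fderiv_metric_symm hs hG v u w,
    fderiv_metric_symm hs hG w u v]
  ring

/-- The gradient of a function in coordinates. -/
def gradientCoord (G : E → E →L[ℝ] E →L[ℝ] ℝ) (h : E → ℝ) (y : E) : E :=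
  (G y).inverse (fderiv ℝ h y)

theorem metric_gradientCoord (hy : (G y).IsInvertible) (h : E → ℝ) (v : E) :
    G y (gradientCoord G h y) v = fderiv ℝ h y v := by
  rw [gradientCoord, hy.self_apply_inverse]

theorem contDiffAt_gradientCoord [FiniteDimensional ℝ E] {h : E → ℝ}
    (hG : ContDiffAt ℝ 2 G y) (hy : (G y).IsInvertible) (hh : ContDiffAt ℝ 2 h y) : ContDiffAt ℝ 1 (gradientCoord G h) y :=
  (contDiffAt_inverse (hG.of_le (by norm_num)) hy).clm_apply (hh.fderiv_right (by norm_num))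

/-- The covariant derivative of the gradient is the Hessian. -/
theorem fderiv_gradientCoord [FiniteDimensional ℝ E] {h : E → ℝ} (hs : ∀ z u v, G z u v = G z v u)
    (hG : ContDiffAt ℝ 2 G y) (hy : (G y).IsInvertible) (hh : ContDiffAt ℝ 2 h y) (u : E) :
    fderiv ℝ (gradientCoord G h) y u + christoffel G y u (gradientCoord G h y) =
      (G y).inverse (hessianCoord G h y u) := by
  have hGd : DifferentiableAt ℝ G y := hG.differentiableAt (by norm_num)
  have hX := ((contDiffAt_gradientCoord hG hy hh).differentiableAt (by norm_num)).hasFDerivAt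
  have hdh : HasFDerivAt (fderiv ℝ h) (fderiv ℝ (fderiv ℝ h) y) y :=
    ((hh.fderiv_right (m := 1) (by norm_num)).differentiableAt (by norm_num)).hasFDerivAt
  -- The relation `G(∇h, ·) = dh` holds on a neighbourhood, so both sides have the same derivative;
  -- metric compatibility then turns the derivative of `G` into Christoffel terms.
  have hev : (fun z ↦ G z (gradientCoord G h z)) =ᶠ[𝓝 y] fderiv ℝ h := by
    filter_upwards [eventually_isInvertible hGd.continuousAt hy] with z hz
    ext v
    exact metric_gradientCoord hz h v
  have key := congrArg (fun L : E →L[ℝ] E →L[ℝ] ℝ ↦ L u)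
    ((hGd.hasFDerivAt.clm_apply hX).unique (hdh.congr_of_eventuallyEq hev))
  refine ((hy.inverse_apply_eq).2 ?_).symm
  ext v
  have kv := congrArg (fun L : E →L[ℝ] ℝ ↦ L v) key
  simp only [add_apply, ContinuousLinearMap.comp_apply, ContinuousLinearMap.flip_apply] at kv
  rw [fderiv_metric hs hGd hy, metric_gradientCoord hy] at kv
  rw [hessianCoord_apply, map_add, add_apply]
  linarith

/-- The trace of an endomorphism of a product is the sum of the traces of its diagonal blocks. -/
theorem trace_eq_add_trace_blocks {V W : Type*} [AddCommGroup V] [Module ℝ V] [Module.Finite ℝ V]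
    [AddCommGroup W] [Module ℝ W] [Module.Finite ℝ W] (T : V × W →ₗ[ℝ] V × W) :
    LinearMap.trace ℝ (V × W) T =
      LinearMap.trace ℝ V (LinearMap.fst ℝ V W ∘ₗ T ∘ₗ LinearMap.inl ℝ V W)
        + LinearMap.trace ℝ W (LinearMap.snd ℝ V W ∘ₗ T ∘ₗ LinearMap.inr ℝ V W) := by
  -- Splitting `T` by columns and using the cyclicity of the trace moves each projection to the
  -- left, which leaves the diagonal blocks.
  have h : T = (T ∘ₗ LinearMap.inl ℝ V W) ∘ₗ LinearMap.fst ℝ V W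
      + (T ∘ₗ LinearMap.inr ℝ V W) ∘ₗ LinearMap.snd ℝ V W := by
    refine LinearMap.ext fun z ↦ ?_
    simp only [LinearMap.add_apply, LinearMap.comp_apply, LinearMap.fst_apply, LinearMap.snd_apply,
      LinearMap.inl_apply, LinearMap.inr_apply, ← map_add, Prod.mk_add_mk, add_zero, zero_add]
  conv_lhs => rw [h]
  rw [map_add, LinearMap.trace_comp_comm', LinearMap.trace_comp_comm' (LinearMap.snd ℝ V W)]

theorem christoffel_congr {G' : E → E →L[ℝ] E →L[ℝ] ℝ} (h : G =ᶠ[𝓝 y] G') :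
    christoffel G =ᶠ[𝓝 y] christoffel G' := by
  filter_upwards [h, h.fderiv (𝕜 := ℝ)] with z hz hz'
  rw [christoffel, christoffel, christoffelFirst, christoffelFirst, hz, hz']

/-- Curvature depends only on the germ of the metric. This is needed because the chart expression of
the warped metric is known only near the base point. -/
theorem ricciCoord_congr {G' : E → E →L[ℝ] E →L[ℝ] ℝ} (h : G =ᶠ[𝓝 y] G') (v w : E) :
    ricciCoord G y v w = ricciCoord G' y v w := by
  have h1 := christoffel_congr h
  rw [ricciCoord, ricciCoord, curvatureEndo, curvatureEndo, h1.eq_of_nhds, h1.fderiv_eq]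

theorem hessianCoord_congr {G' : E → E →L[ℝ] E →L[ℝ] ℝ} (h : G =ᶠ[𝓝 y] G') {a b : E → ℝ}
    (hab : a =ᶠ[𝓝 y] b) : hessianCoord G a y = hessianCoord G' b y := by
  rw [hessianCoord, hessianCoord, (christoffel_congr h).eq_of_nhds, hab.fderiv_eq,
    (hab.fderiv (𝕜 := ℝ)).fderiv_eq]

end Coordinates

/-! ### Warped products in product coordinates: connection and Hessians. -/

section WarpedCoordinates

variable {V : Type*} [NormedAddCommGroup V] [NormedSpace ℝ V]
  {W : Type*} [NormedAddCommGroup W] [NormedSpace ℝ W]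

/-- The coefficients of a warped product metric in product coordinates. -/
def warpedCoord (GB : V → V →L[ℝ] V →L[ℝ] ℝ) (GF : W → W →L[ℝ] W →L[ℝ] ℝ) (φ : V → ℝ) (z : V × W) :
    V × W →L[ℝ] V × W →L[ℝ] ℝ :=
  pullbackForm (GB z.1) (ContinuousLinearMap.fst ℝ V W)
    + (φ z.1) ^ 2 • pullbackForm (GF z.2) (ContinuousLinearMap.snd ℝ V W)

variable {GB : V → V →L[ℝ] V →L[ℝ] ℝ} {GF : W → W →L[ℝ] W →L[ℝ] ℝ} {φ : V → ℝ} {z : V × W}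

theorem warpedCoord_apply (GB : V → V →L[ℝ] V →L[ℝ] ℝ) (GF : W → W →L[ℝ] W →L[ℝ] ℝ) (φ : V → ℝ)
    (z u v : V × W) :
    warpedCoord GB GF φ z u v = GB z.1 u.1 v.1 + (φ z.1) ^ 2 * GF z.2 u.2 v.2 := rfl

theorem contDiffAt_warpedCoord {n : WithTop ℕ∞} (hB : ContDiffAt ℝ n GB z.1)
    (hF : ContDiffAt ℝ n GF z.2) (hφ : ContDiffAt ℝ n φ z.1) :
    ContDiffAt ℝ n (warpedCoord GB GF φ) z := by
  have h1 : ContDiffAt ℝ n (fun z : V × W ↦ GB z.1) z := hB.comp z contDiffAt_fst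
  have h2 : ContDiffAt ℝ n (fun z : V × W ↦ GF z.2) z := hF.comp z contDiffAt_snd
  have h3 : ContDiffAt ℝ n (fun z : V × W ↦ φ z.1) z := hφ.comp z contDiffAt_fst
  exact ((contDiffAt_const.clm_comp h1).clm_comp contDiffAt_const).add
    ((h3.pow 2).smul ((contDiffAt_const.clm_comp h2).clm_comp contDiffAt_const))

theorem isInvertible_warpedCoord [FiniteDimensional ℝ V] [FiniteDimensional ℝ W]
    (hB : (GB z.1).IsInvertible) (hF : (GF z.2).IsInvertible) (hφ : φ z.1 ≠ 0) :
    (warpedCoord GB GF φ z).IsInvertible := by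
  refine isInvertible_of_nondegenerate fun u hu ↦ ?_
  have h1 : GB z.1 u.1 = 0 := by
    ext v
    simpa [warpedCoord_apply] using congrArg (fun L : V × W →L[ℝ] ℝ ↦ L (v, 0)) hu
  have h2 : GF z.2 u.2 = 0 := by
    ext v
    simpa [warpedCoord_apply, hφ] using congrArg (fun L : V × W →L[ℝ] ℝ ↦ L (0, v)) hu
  exact Prod.ext (hB.injective (h1.trans (map_zero _).symm))
    (hF.injective (h2.trans (map_zero _).symm))

theorem fderiv_warpedCoord (hB : DifferentiableAt ℝ GB z.1) (hF : DifferentiableAt ℝ GF z.2)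
    (hφ : DifferentiableAt ℝ φ z.1) (t u v : V × W) :
    fderiv ℝ (warpedCoord GB GF φ) z t u v =
      fderiv ℝ GB z.1 t.1 u.1 v.1 + 2 * φ z.1 * fderiv ℝ φ z.1 t.1 * GF z.2 u.2 v.2
        + (φ z.1) ^ 2 * fderiv ℝ GF z.2 t.2 u.2 v.2 := by
  have h1 := hB.hasFDerivAt.comp z hasFDerivAt_fst
  have h2 := hF.hasFDerivAt.comp z hasFDerivAt_snd
  have h3 := hφ.hasFDerivAt.comp z hasFDerivAt_fst
  have h := (((hasFDerivAt_const (ContinuousLinearMap.precomp ℝ (ContinuousLinearMap.fst ℝ V W))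
      z).clm_comp h1).clm_comp (hasFDerivAt_const (ContinuousLinearMap.fst ℝ V W) z)).add
    ((h3.pow 2).smul (((hasFDerivAt_const
      (ContinuousLinearMap.precomp ℝ (ContinuousLinearMap.snd ℝ V W)) z).clm_comp h2).clm_comp
        (hasFDerivAt_const (ContinuousLinearMap.snd ℝ V W) z)))
  have h' : HasFDerivAt (warpedCoord GB GF φ) _ z := h
  rw [h'.fderiv]
  simp
  ring

theorem christoffel_warpedCoord [FiniteDimensional ℝ V] [FiniteDimensional ℝ W]
    (hB : DifferentiableAt ℝ GB z.1) (hF : DifferentiableAt ℝ GF z.2)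
    (hφ : DifferentiableAt ℝ φ z.1)
    (hBi : (GB z.1).IsInvertible) (hFi : (GF z.2).IsInvertible) (hφ0 : φ z.1 ≠ 0) (u v : V × W) :
    christoffel (warpedCoord GB GF φ) z u v =
      (christoffel GB z.1 u.1 v.1 - (φ z.1 * GF z.2 u.2 v.2) • gradientCoord GB φ z.1,
        christoffel GF z.2 u.2 v.2 + (fderiv ℝ φ z.1 u.1 / φ z.1) • v.2
          + (fderiv ℝ φ z.1 v.1 / φ z.1) • u.2) := by
  -- No inverse of the warped metric is computed: the claimed vector is lowered with the metric and
  -- compared with the Koszul formula. The terms in `dφ` come from differentiating `φ²`.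
  rw [christoffel_apply, (isInvertible_warpedCoord hBi hFi hφ0).inverse_apply_eq]
  refine ContinuousLinearMap.ext fun w ↦ ?_
  rw [christoffelFirst_apply, fderiv_warpedCoord hB hF hφ, fderiv_warpedCoord hB hF hφ,
    fderiv_warpedCoord hB hF hφ, warpedCoord_apply]
  simp only [map_sub, map_add, map_smul, sub_apply, add_apply, smul_apply, smul_eq_mul,
    metric_christoffel hBi, metric_christoffel hFi, metric_gradientCoord hBi,
    christoffelFirst_apply]
  field_simp
  ring

/-- `G` is a symmetric field of bilinear forms that is `C²` and nondegenerate at `y`. -/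
structure IsMetricAt {E : Type*} [NormedAddCommGroup E] [NormedSpace ℝ E]
    (G : E → E →L[ℝ] E →L[ℝ] ℝ) (y : E) : Prop where
  symm : ∀ z u v, G z u v = G z v u
  contDiffAt : ContDiffAt ℝ 2 G y
  isInvertible : (G y).IsInvertible

theorem IsMetricAt.differentiableAt {E : Type*} [NormedAddCommGroup E] [NormedSpace ℝ E]
    {G : E → E →L[ℝ] E →L[ℝ] ℝ} {y : E} (h : IsMetricAt G y) : DifferentiableAt ℝ G y :=
  h.contDiffAt.differentiableAt (by norm_num)

theorem eventually_differentiableAt_of_contDiffAt_two {E E' : Type*} [NormedAddCommGroup E]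
    [NormedSpace ℝ E] [NormedAddCommGroup E'] [NormedSpace ℝ E'] {h : E → E'} {y : E}
    (hh : ContDiffAt ℝ 2 h y) : ∀ᶠ y' in 𝓝 y, DifferentiableAt ℝ h y' :=
  (hh.eventually (by decide)).mono fun _ h' ↦ h'.differentiableAt (by norm_num)

/-- The pointwise formula on a whole neighbourhood, as required for differentiating the Christoffel
symbols. -/
theorem eventually_christoffel_warpedCoord [FiniteDimensional ℝ V] [FiniteDimensional ℝ W]
    (hB : IsMetricAt GB z.1) (hF : IsMetricAt GF z.2) (hφ : ContDiffAt ℝ 2 φ z.1)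
    (hφ0 : φ z.1 ≠ 0) : ∀ᶠ z' in 𝓝 z, ∀ u v : V × W,
    christoffel (warpedCoord GB GF φ) z' u v =
      (christoffel GB z'.1 u.1 v.1 - (φ z'.1 * GF z'.2 u.2 v.2) • gradientCoord GB φ z'.1,
        christoffel GF z'.2 u.2 v.2 + (fderiv ℝ φ z'.1 u.1 / φ z'.1) • v.2
          + (fderiv ℝ φ z'.1 v.1 / φ z'.1) • u.2) := by
  have t1 : Filter.Tendsto Prod.fst (𝓝 z) (𝓝 z.1) := continuousAt_fst
  have t2 : Filter.Tendsto Prod.snd (𝓝 z) (𝓝 z.2) := continuousAt_snd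
  filter_upwards [t1.eventually (eventually_differentiableAt_of_contDiffAt_two hB.contDiffAt),
    t2.eventually (eventually_differentiableAt_of_contDiffAt_two hF.contDiffAt),
    t1.eventually (eventually_differentiableAt_of_contDiffAt_two hφ),
    t1.eventually (eventually_isInvertible hB.contDiffAt.continuousAt hB.isInvertible),
    t2.eventually (eventually_isInvertible hF.contDiffAt.continuousAt hF.isInvertible),
    t1.eventually (hφ.continuousAt.eventually_ne hφ0)] with z' h1 h2 h3 h4 h5 h6 u v
  exact christoffel_warpedCoord h1 h2 h3 h4 h5 h6 u v

theorem hasFDerivAt_apply_apply {X E E' E'' : Type*} [NormedAddCommGroup X] [NormedSpace ℝ X]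
    [NormedAddCommGroup E] [NormedSpace ℝ E]
    [NormedAddCommGroup E'] [NormedSpace ℝ E'] [NormedAddCommGroup E''] [NormedSpace ℝ E'']
    {L : X → E →L[ℝ] E' →L[ℝ] E''} {L' : X →L[ℝ] E →L[ℝ] E' →L[ℝ] E''} {x : X}
    (h : HasFDerivAt L L' x) (u : E) (v : E') :
    HasFDerivAt (fun x ↦ L x u v) ((L'.flip u).flip v) x := by
  refine ((h.clm_apply (hasFDerivAt_const u x)).clm_apply (hasFDerivAt_const v x)).congr_fderiv ?_
  ext; simp

theorem fderiv_christoffel_warpedCoord [FiniteDimensional ℝ V] [FiniteDimensional ℝ W]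
    (hB : IsMetricAt GB z.1) (hF : IsMetricAt GF z.2) (hφ : ContDiffAt ℝ 2 φ z.1)
    (hφ0 : φ z.1 ≠ 0) (t u v : V × W) :
    fderiv ℝ (christoffel (warpedCoord GB GF φ)) z t u v =
      (fderiv ℝ (christoffel GB) z.1 t.1 u.1 v.1
          - (φ z.1 * GF z.2 u.2 v.2) • fderiv ℝ (gradientCoord GB φ) z.1 t.1
          - (fderiv ℝ φ z.1 t.1 * GF z.2 u.2 v.2 + φ z.1 * fderiv ℝ GF z.2 t.2 u.2 v.2) •
            gradientCoord GB φ z.1,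
        fderiv ℝ (christoffel GF) z.2 t.2 u.2 v.2
          + (fderiv ℝ (fderiv ℝ φ) z.1 t.1 u.1 / φ z.1
              - fderiv ℝ φ z.1 t.1 * fderiv ℝ φ z.1 u.1 / φ z.1 ^ 2) • v.2
          + (fderiv ℝ (fderiv ℝ φ) z.1 t.1 v.1 / φ z.1
              - fderiv ℝ φ z.1 t.1 * fderiv ℝ φ z.1 v.1 / φ z.1 ^ 2) • u.2) := by
  have hC := ((contDiffAt_christoffel (contDiffAt_warpedCoord hB.contDiffAt hF.contDiffAt hφ)
    (isInvertible_warpedCoord hB.isInvertible hF.isInvertible hφ0)).differentiableAt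
      (by norm_num)).hasFDerivAt
  have hΓB := (hasFDerivAt_apply_apply ((contDiffAt_christoffel hB.contDiffAt
    hB.isInvertible).differentiableAt (by norm_num)).hasFDerivAt u.1 v.1).comp z hasFDerivAt_fst
  have hΓF := (hasFDerivAt_apply_apply ((contDiffAt_christoffel hF.contDiffAt
    hF.isInvertible).differentiableAt (by norm_num)).hasFDerivAt u.2 v.2).comp z hasFDerivAt_snd
  have hGF := (hasFDerivAt_apply_apply hF.differentiableAt.hasFDerivAt u.2 v.2).comp z
    hasFDerivAt_snd
  have hX := ((contDiffAt_gradientCoord hB.contDiffAt hB.isInvertible hφ).differentiableAt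
    (by norm_num)).hasFDerivAt.comp z hasFDerivAt_fst
  have hφ1 := (hφ.differentiableAt (by norm_num)).hasFDerivAt.comp z hasFDerivAt_fst
  have hdφ : HasFDerivAt (fderiv ℝ φ) (fderiv ℝ (fderiv ℝ φ) z.1) z.1 :=
    ((hφ.fderiv_right (m := 1) (by norm_num)).differentiableAt (by norm_num)).hasFDerivAt
  -- The quotient is differentiated as `dφ(w) · φ⁻¹`, the source of the two terms over `φ` and `φ²`.
  have hlog (w : V) : HasFDerivAt (fun z' : V × W ↦ fderiv ℝ φ z'.1 w / φ z'.1) _ z :=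
    ((hdφ.clm_apply (hasFDerivAt_const w z.1)).comp z hasFDerivAt_fst).mul
      ((hasDerivAt_inv (x := (φ ∘ Prod.fst) z) hφ0).comp_hasFDerivAt z hφ1)
  have hR := (hΓB.sub ((hφ1.mul hGF).smul hX)).prodMk
    ((hΓF.add ((hlog u.1).smul_const v.2)).add ((hlog v.1).smul_const u.2))
  have hev : (fun z' ↦ christoffel (warpedCoord GB GF φ) z' u v) =ᶠ[𝓝 z] _ :=
    (eventually_christoffel_warpedCoord hB hF hφ hφ0).mono fun z' h ↦ h u v
  have key := congrArg (fun L : V × W →L[ℝ] V × W ↦ L t)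
    ((hasFDerivAt_apply_apply hC u v).unique (hR.congr_of_eventuallyEq hev))
  refine key.trans ?_
  refine Prod.ext ?_ ?_
  · simp
    module
  · simp
    ring_nf

/-- The differential of a sum of a function on the base and a function on the fibre. -/
theorem hasFDerivAt_sum_pullbacks {α : V → ℝ} {β : W → ℝ} {z : V × W}
    (hα : DifferentiableAt ℝ α z.1) (hβ : DifferentiableAt ℝ β z.2) :
    HasFDerivAt (fun z : V × W ↦ α z.1 + β z.2)
      (fderiv ℝ α z.1 ∘L ContinuousLinearMap.fst ℝ V W
        + fderiv ℝ β z.2 ∘L ContinuousLinearMap.snd ℝ V W) z :=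
  (hα.hasFDerivAt.comp z hasFDerivAt_fst).add (hβ.hasFDerivAt.comp z hasFDerivAt_snd)

/-- There are no mixed second derivatives, so the base–fibre cross term in the Hessian of the total
weight comes from the connection alone. -/
theorem fderiv_fderiv_sum_pullbacks {α : V → ℝ} {β : W → ℝ}
    (hα : ContDiffAt ℝ 2 α z.1) (hβ : ContDiffAt ℝ 2 β z.2) (u v : V × W) :
    fderiv ℝ (fderiv ℝ (fun z : V × W ↦ α z.1 + β z.2)) z u v =
      fderiv ℝ (fderiv ℝ α) z.1 u.1 v.1 + fderiv ℝ (fderiv ℝ β) z.2 u.2 v.2 := by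
  have t1 : Filter.Tendsto Prod.fst (𝓝 z) (𝓝 z.1) := continuousAt_fst
  have t2 : Filter.Tendsto Prod.snd (𝓝 z) (𝓝 z.2) := continuousAt_snd
  have hev : fderiv ℝ (fun z : V × W ↦ α z.1 + β z.2) =ᶠ[𝓝 z] fun z ↦
      fderiv ℝ α z.1 ∘L ContinuousLinearMap.fst ℝ V W
        + fderiv ℝ β z.2 ∘L ContinuousLinearMap.snd ℝ V W := by
    filter_upwards [t1.eventually (eventually_differentiableAt_of_contDiffAt_two hα),
      t2.eventually (eventually_differentiableAt_of_contDiffAt_two hβ)] with z' h1 h2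
    exact (hasFDerivAt_sum_pullbacks h1 h2).fderiv
  have hdα : HasFDerivAt (fderiv ℝ α) (fderiv ℝ (fderiv ℝ α) z.1) z.1 :=
    ((hα.fderiv_right (m := 1) (by norm_num)).differentiableAt (by norm_num)).hasFDerivAt
  have hdβ : HasFDerivAt (fderiv ℝ β) (fderiv ℝ (fderiv ℝ β) z.2) z.2 :=
    ((hβ.fderiv_right (m := 1) (by norm_num)).differentiableAt (by norm_num)).hasFDerivAt
  have h := ((hdα.comp z hasFDerivAt_fst).clm_comp
    (hasFDerivAt_const (ContinuousLinearMap.fst ℝ V W) z)).add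
      ((hdβ.comp z hasFDerivAt_snd).clm_comp
        (hasFDerivAt_const (ContinuousLinearMap.snd ℝ V W) z))
  rw [(h.congr_of_eventuallyEq hev).fderiv]
  simp

theorem fderiv_const_mul_log {φ : V → ℝ} {y : V} (c : ℝ) (hφ : DifferentiableAt ℝ φ y)
    (hφ0 : φ y ≠ 0) :
    fderiv ℝ (fun y ↦ c * Real.log (φ y)) y = (c * (φ y)⁻¹) • fderiv ℝ φ y := by
  rw [((hφ.hasFDerivAt.log hφ0).const_mul c).fderiv, smul_smul]

/-- The Hessian of a multiple of `log φ`. -/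
theorem hessianCoord_const_mul_log {φ : V → ℝ} {y : V} (c : ℝ) (hφ : ContDiffAt ℝ 2 φ y)
    (hφ0 : φ y ≠ 0) (u : V) :
    hessianCoord GB (fun y ↦ c * Real.log (φ y)) y u u =
      c * (hessianCoord GB φ y u u / φ y - (fderiv ℝ φ y u / φ y) ^ 2) := by
  have hφd : DifferentiableAt ℝ φ y := hφ.differentiableAt (by norm_num)
  have hev : fderiv ℝ (fun y ↦ c * Real.log (φ y)) =ᶠ[𝓝 y]
      fun y ↦ (c * (φ y)⁻¹) • fderiv ℝ φ y := by
    filter_upwards [eventually_differentiableAt_of_contDiffAt_two hφ,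
      hφ.continuousAt.eventually_ne hφ0] with y' h1 h2
    exact fderiv_const_mul_log c h1 h2
  have hdφ : HasFDerivAt (fderiv ℝ φ) (fderiv ℝ (fderiv ℝ φ) y) y :=
    ((hφ.fderiv_right (m := 1) (by norm_num)).differentiableAt (by norm_num)).hasFDerivAt
  have h := (((hasDerivAt_inv hφ0).comp_hasFDerivAt y hφd.hasFDerivAt).const_mul c).smul hdφ
  have h' := h.congr_of_eventuallyEq hev
  rw [hessianCoord_apply, hessianCoord_apply, h'.fderiv, fderiv_const_mul_log c hφd hφ0]
  simp
  field_simp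
  ring

end WarpedCoordinates

/-! ### Diagonal curvature blocks and the Ricci tensor of a warped product. -/

section WarpedCurvature

variable {V : Type*} [NormedAddCommGroup V] [NormedSpace ℝ V] [FiniteDimensional ℝ V]
  {W : Type*} [NormedAddCommGroup W] [NormedSpace ℝ W] [FiniteDimensional ℝ W]
  {GB : V → V →L[ℝ] V →L[ℝ] ℝ} {GF : W → W →L[ℝ] W →L[ℝ] ℝ} {φ : V → ℝ} {z : V × W}

/-- The derivative of the gradient and its Christoffel correction assemble into the Hessian. -/
theorem curvatureEndo_warpedCoord_base (hB : IsMetricAt GB z.1) (hF : IsMetricAt GF z.2)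
    (hφ : ContDiffAt ℝ 2 φ z.1) (hφ0 : φ z.1 ≠ 0) (w : V × W) (u : V) :
    (curvatureEndo (warpedCoord GB GF φ) z w w (u, 0)).1 =
      curvatureEndo GB z.1 w.1 w.1 u
        - (φ z.1 * GF z.2 w.2 w.2) • (GB z.1).inverse (hessianCoord GB φ z.1 u) := by
  have hΓ := (eventually_christoffel_warpedCoord hB hF hφ hφ0).self_of_nhds
  rw [← fderiv_gradientCoord hB.symm hB.contDiffAt hB.isInvertible hφ u, curvatureEndo_apply,
    curvatureEndo_apply]
  simp only [fderiv_christoffel_warpedCoord hB hF hφ hφ0, hΓ, map_zero, zero_apply, map_sub,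
    map_add, map_smul, smul_eq_mul, smul_zero, add_zero, zero_add, mul_zero, zero_smul, sub_zero,
    Prod.fst_add, Prod.fst_sub]
  -- This mixed Christoffel contribution cancels the term obtained by differentiating the factor `φ`
  -- in front of the gradient.
  have h : φ z.1 * (fderiv ℝ φ z.1 u / φ z.1 * GF z.2 w.2 w.2)
      = fderiv ℝ φ z.1 u * GF z.2 w.2 w.2 := by field_simp
  rw [h]
  module

/-- The multiple of `a` has trace proportional to `n`. The last term has rank one and trace `|∇φ|²
GF(w₂, w₂)`, which lowers the coefficient of the gradient term from `n` to `n - 1`. -/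
theorem curvatureEndo_warpedCoord_fibre (hB : IsMetricAt GB z.1) (hF : IsMetricAt GF z.2)
    (hφ : ContDiffAt ℝ 2 φ z.1) (hφ0 : φ z.1 ≠ 0) (w : V × W) (a : W) :
    (curvatureEndo (warpedCoord GB GF φ) z w w (0, a)).2 =
      curvatureEndo GF z.2 w.2 w.2 a
        - (hessianCoord GB φ z.1 w.1 w.1 / φ z.1
            + GF z.2 w.2 w.2 * fderiv ℝ φ z.1 (gradientCoord GB φ z.1)) • a
        + (fderiv ℝ φ z.1 (gradientCoord GB φ z.1) * GF z.2 w.2 a) • w.2 := by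
  have hΓ := (eventually_christoffel_warpedCoord hB hF hφ hφ0).self_of_nhds
  rw [curvatureEndo_apply, curvatureEndo_apply, hessianCoord_apply]
  simp only [fderiv_christoffel_warpedCoord hB hF hφ hφ0, hΓ, map_zero, zero_apply, map_sub,
    map_add, map_smul, smul_eq_mul, smul_zero, add_zero, zero_add, mul_zero, zero_smul, sub_zero,
    zero_div, zero_mul, zero_sub, map_neg, Prod.snd_add, Prod.snd_sub,
    christoffel_symm hF.symm hF.differentiableAt a w.2, hF.symm z.2 a w.2]
  match_scalars <;> field_simp <;> ring

/-- The Ricci curvature of a warped product in product coordinates. -/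
theorem ricciCoord_warpedCoord (hB : IsMetricAt GB z.1) (hF : IsMetricAt GF z.2)
    (hφ : ContDiffAt ℝ 2 φ z.1) (hφ0 : φ z.1 ≠ 0) (w : V × W) :
    ricciCoord (warpedCoord GB GF φ) z w w =
      ricciCoord GB z.1 w.1 w.1 - Module.finrank ℝ W * (hessianCoord GB φ z.1 w.1 w.1 / φ z.1)
        + ricciCoord GF z.2 w.2 w.2
        - (φ z.1 * laplacianCoord GB φ z.1
            + (Module.finrank ℝ W - 1) * fderiv ℝ φ z.1 (gradientCoord GB φ z.1))
          * GF z.2 w.2 w.2 := by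
  have h1 : LinearMap.fst ℝ V W ∘ₗ (curvatureEndo (warpedCoord GB GF φ) z w w : V × W →ₗ[ℝ] V × W)
      ∘ₗ LinearMap.inl ℝ V W = (curvatureEndo GB z.1 w.1 w.1 : V →ₗ[ℝ] V)
        - (φ z.1 * GF z.2 w.2 w.2) •
          (((GB z.1).inverse ∘L hessianCoord GB φ z.1 : V →L[ℝ] V) : V →ₗ[ℝ] V) :=
    LinearMap.ext fun u ↦ curvatureEndo_warpedCoord_base hB hF hφ hφ0 w u
  have h2 : LinearMap.snd ℝ V W ∘ₗ (curvatureEndo (warpedCoord GB GF φ) z w w : V × W →ₗ[ℝ] V × W)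
      ∘ₗ LinearMap.inr ℝ V W = (curvatureEndo GF z.2 w.2 w.2 : W →ₗ[ℝ] W)
        - (hessianCoord GB φ z.1 w.1 w.1 / φ z.1
            + GF z.2 w.2 w.2 * fderiv ℝ φ z.1 (gradientCoord GB φ z.1)) • LinearMap.id
        + (fderiv ℝ φ z.1 (gradientCoord GB φ z.1) • (GF z.2 w.2 : W →ₗ[ℝ] ℝ)).smulRight w.2 :=
    LinearMap.ext fun a ↦ curvatureEndo_warpedCoord_fibre hB hF hφ hφ0 w a
  rw [ricciCoord, trace_eq_add_trace_blocks, h1, h2, map_add, map_sub, map_sub, map_smul, map_smul,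
    LinearMap.trace_id, LinearMap.trace_smulRight, ricciCoord, ricciCoord, laplacianCoord]
  simp only [smul_eq_mul, LinearMap.smul_apply, ContinuousLinearMap.coe_coe]
  ring

/-- The Hessian, with respect to a warped product metric, of a sum of a function on the base and a
function on the fibre. -/
theorem hessianCoord_warpedCoord {α : V → ℝ} {β : W → ℝ}
    (hB : IsMetricAt GB z.1) (hF : IsMetricAt GF z.2)
    (hφ : ContDiffAt ℝ 2 φ z.1) (hφ0 : φ z.1 ≠ 0)
    (hα : ContDiffAt ℝ 2 α z.1) (hβ : ContDiffAt ℝ 2 β z.2) (w : V × W) :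
    hessianCoord (warpedCoord GB GF φ) (fun z ↦ α z.1 + β z.2) z w w =
      hessianCoord GB α z.1 w.1 w.1 + hessianCoord GF β z.2 w.2 w.2
        + φ z.1 * GF z.2 w.2 w.2 * fderiv ℝ α z.1 (gradientCoord GB φ z.1)
        - 2 * (fderiv ℝ φ z.1 w.1 / φ z.1) * fderiv ℝ β z.2 w.2 := by
  have hΓ := (eventually_christoffel_warpedCoord hB hF hφ hφ0).self_of_nhds
  rw [hessianCoord_apply, fderiv_fderiv_sum_pullbacks hα hβ, (hasFDerivAt_sum_pullbacks
    (hα.differentiableAt (by norm_num)) (hβ.differentiableAt (by norm_num))).fderiv, hΓ,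
    hessianCoord_apply, hessianCoord_apply]
  simp only [add_apply, ContinuousLinearMap.comp_apply, ContinuousLinearMap.coe_fst',
    ContinuousLinearMap.coe_snd', map_add, map_sub, map_smul, smul_eq_mul]
  ring

end WarpedCurvature

theorem two_le_infty : (2 : WithTop ℕ∞) ≤ ∞ := WithTop.coe_le_coe.2 (le_top : (2 : ℕ∞) ≤ ⊤)

/-! ### From manifold tensors to their expressions in the preferred chart. -/

section Charts

variable {E : Type*} [NormedAddCommGroup E] [NormedSpace ℝ E]
  {H : Type*} [TopologicalSpace H] {I : ModelWithCorners ℝ E H}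
  {M : Type*} [TopologicalSpace M] [ChartedSpace H M]

theorem mvfderiv_apply_eq_fderiv [I.Boundaryless] {h : M → ℝ} {p : M} (hh : MDifferentiableAt I 𝓘(ℝ, ℝ) h p)
    (v : TangentSpace I p) :
    mvfderiv I h p v = fderiv ℝ (h ∘ (extChartAt I p).symm) (extChartAt I p p) v := by
  have h1 : mfderiv I 𝓘(ℝ, ℝ) h p =
      fderivWithin ℝ (writtenInExtChartAt I 𝓘(ℝ, ℝ) p h) (Set.range I) (extChartAt I p p) := by
    rw [hh.mfderiv]
  rw [I.range_eq_univ, fderivWithin_univ] at h1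
  change mfderiv I 𝓘(ℝ, ℝ) h p v = _
  rw [h1]
  rfl

variable [IsManifold I ∞ M]

theorem metricInChart_symm (g : RiemMetric I M) (p : M) (y u v : E) :
    metricInChart g p y u v = metricInChart g p y v u := by
  rw [metricInChart_apply, metricInChart_apply, g.symm]

variable [I.Boundaryless]

theorem contMDiffAt_extChartAt_symm {p : M} {y : E} (hy : y ∈ (extChartAt I p).target) :
    ContMDiffAt 𝓘(ℝ, E) I ∞ (extChartAt I p).symm y :=
  (contMDiffOn_extChartAt_symm p).contMDiffAt ((isOpen_extChartAt_target p).mem_nhds hy)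

/-- At its own centre the inverse preferred chart has the identity as derivative, since tangent
vectors are represented by their coordinates in that chart. -/
theorem metricInChart_self (g : RiemMetric I M) (p : M) (u v : E) :
    metricInChart g p (extChartAt I p p) u v = g.inner p u v := by
  have h1 : mfderiv 𝓘(ℝ, E) I (extChartAt I p).symm (extChartAt I p p) =
      ContinuousLinearMap.id ℝ E := by
    have : IsManifold I 1 M := .of_le (n := ∞) (by simp)
    have := mfderivWithin_range_extChartAt_symm (I := I) (x := p)
    rwa [I.range_eq_univ, mfderivWithin_univ] at this
  rw [metricInChart_apply, h1]
  -- The tangent space depends on the base point, so the equality of points is eliminated with a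
  -- variable `q`.
  have h2 : ∀ q : M, q = p → g.inner q u v = g.inner p u v := by rintro q rfl; rfl
  exact h2 _ (extChartAt_to_inv p)

/-- Smoothness of `g` is known in the trivialization at `p`. On the chart target the derivative of
the inverse chart is the inverse trivialization, so both give the same coefficients. -/
theorem contDiffAt_metricInChart (g : RiemMetric I M) (p : M) :
    ContDiffAt ℝ ∞ (metricInChart g p) (extChartAt I p p) := by
  have : IsManifold I 1 M := .of_le (n := ∞) (by simp)
  have h := (contMDiffAt_hom_bundle _).1 (g.contMDiff p)
  have hs := contMDiffAt_extChartAt_symm (mem_extChartAt_target (I := I) p)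
  have h3 := h.2.comp_of_eq hs (extChartAt_to_inv p)
  refine (contMDiffAt_iff_contDiffAt.1 h3).congr_of_eventuallyEq ?_
  filter_upwards [(isOpen_extChartAt_target p).mem_nhds (mem_extChartAt_target (I := I) p)]
    with y hy
  have hy' : (extChartAt I p).symm y ∈ (chartAt H p).source := by
    simpa using (extChartAt I p).map_target hy
  have hsy : mfderiv 𝓘(ℝ, E) I (extChartAt I p).symm y =
      (trivializationAt E (TangentSpace I) p).symmL ℝ ((extChartAt I p).symm y) := by
    rw [TangentBundle.symmL_trivializationAt hy', (extChartAt I p).right_inv hy, I.range_eq_univ,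
      mfderivWithin_univ]
  refine Eq.trans ?_ (inCoordinates_form p _ (g.inner ((extChartAt I p).symm y)) hy').symm
  rw [metricInChart, hsy]
  rfl

theorem isMetricAt_metricInChart [FiniteDimensional ℝ E] (g : RiemMetric I M) (p : M) :
    IsMetricAt (metricInChart g p) (extChartAt I p p) where
  symm := metricInChart_symm g p
  contDiffAt := (contDiffAt_metricInChart g p).of_le two_le_infty
  isInvertible := isInvertible_of_nondegenerate fun u hu ↦ by
    by_contra h
    have := g.pos p u h
    rw [← metricInChart_self, hu] at this
    exact lt_irrefl _ this

theorem contDiffAt_comp_extChartAt_symm {h : M → ℝ} (hh : ContMDiff I 𝓘(ℝ, ℝ) ∞ h) (p : M) :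
    ContDiffAt ℝ 2 (h ∘ (extChartAt I p).symm) (extChartAt I p p) :=
  ((contMDiffAt_iff_contDiffAt.1 ((hh _).comp _
    (contMDiffAt_extChartAt_symm (mem_extChartAt_target (I := I) p)))).of_le two_le_infty)

theorem normSq_metricGradient [FiniteDimensional ℝ E] (g : RiemMetric I M) {h : M → ℝ} {p : M}
    (hh : MDifferentiableAt I 𝓘(ℝ, ℝ) h p) :
    normSq g p (metricGradient g h p) =
      fderiv ℝ (h ∘ (extChartAt I p).symm) (extChartAt I p p)
        (gradientCoord (metricInChart g p) (h ∘ (extChartAt I p).symm) (extChartAt I p p)) := by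
  have hg : g.inner p = metricInChart g p (extChartAt I p p) := by
    ext u v
    exact (metricInChart_self g p u v).symm
  have hd : mvfderiv I h p = fderiv ℝ (h ∘ (extChartAt I p).symm) (extChartAt I p p) := by
    ext v
    exact mvfderiv_apply_eq_fderiv hh v
  rw [← metric_gradientCoord (isMetricAt_metricInChart g p).isInvertible, normSq, metricGradient,
    hg, hd]
  rfl

end Charts

/-! ### The warped metric and the lifts in the product chart. -/

section WarpedCharts

variable {EB : Type*} [NormedAddCommGroup EB] [NormedSpace ℝ EB]
  {HB : Type*} [TopologicalSpace HB] {IB : ModelWithCorners ℝ EB HB}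
  {B : Type*} [TopologicalSpace B] [ChartedSpace HB B]
  {EF : Type*} [NormedAddCommGroup EF] [NormedSpace ℝ EF]
  {HF : Type*} [TopologicalSpace HF] {IF : ModelWithCorners ℝ EF HF}
  {F : Type*} [TopologicalSpace F] [ChartedSpace HF F]

theorem horizontalLift_add_verticalLift (p : B) (x : F) (ξ : TangentSpace IB p)
    (v : TangentSpace IF x) :
    @Eq (TangentSpace (IB.prod IF) (p, x)) (horizontalLift p x ξ + verticalLift p x v)
      ((ξ, v) : EB × EF) := by
  rw [horizontalLift, verticalLift, mfderiv_prod_left, mfderiv_prod_right]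
  exact Prod.fst_add_snd (M := EB) (N := EF) (ξ, v)

variable [IsManifold IB ∞ B] [IsManifold IF ∞ F]

/-- The preferred chart at `(p, x)` is the product of those at `p` and `x`, so its inverse has
block-diagonal derivative. -/
theorem metricInChart_warpedMetric [IB.Boundaryless] [IF.Boundaryless]
    (gB : RiemMetric IB B) (gF : RiemMetric IF F) (f : B → ℝ)
    (hf : ContMDiff IB 𝓘(ℝ, ℝ) ∞ f) (hpos : ∀ p, 0 < f p) (p : B) (x : F) :
    metricInChart (warpedMetric gB gF f hf hpos) (p, x)
      =ᶠ[𝓝 (extChartAt (IB.prod IF) (p, x) (p, x))]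
        warpedCoord (metricInChart gB p) (metricInChart gF x) (f ∘ (extChartAt IB p).symm) := by
  filter_upwards [(isOpen_extChartAt_target (I := IB.prod IF) (p, x)).mem_nhds
    (mem_extChartAt_target (I := IB.prod IF) (p, x))] with z hz
  have hz' : z.1 ∈ (extChartAt IB p).target ∧ z.2 ∈ (extChartAt IF x).target := by
    rw [extChartAt_prod] at hz
    exact hz
  have hB := (contMDiffAt_extChartAt_symm hz'.1).mdifferentiableAt (by simp)
  have hF := (contMDiffAt_extChartAt_symm hz'.2).mdifferentiableAt (by simp)
  have hm : HasMFDerivAt 𝓘(ℝ, EB × EF) (IB.prod IF) (extChartAt (IB.prod IF) (p, x)).symm z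
      ((mfderiv 𝓘(ℝ, EB) IB (extChartAt IB p).symm z.1 ∘L ContinuousLinearMap.fst ℝ EB EF).prod
        (mfderiv 𝓘(ℝ, EF) IF (extChartAt IF x).symm z.2 ∘L ContinuousLinearMap.snd ℝ EB EF)) :=
    (hB.hasMFDerivAt.comp z (ContinuousLinearMap.fst ℝ EB EF).hasMFDerivAt).prodMk
      (hF.hasMFDerivAt.comp z (ContinuousLinearMap.snd ℝ EB EF).hasMFDerivAt)
  refine ContinuousLinearMap.ext fun u ↦ ContinuousLinearMap.ext fun v ↦ ?_
  rw [metricInChart_apply, hm.mfderiv]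
  refine (warpedForm_apply gB gF f _ _ _).trans ?_
  rw [mfderiv_fst, mfderiv_snd]
  rfl

theorem normSq_verticalLift (gB : RiemMetric IB B) (gF : RiemMetric IF F) (f : B → ℝ)
    (hf : ContMDiff IB 𝓘(ℝ, ℝ) ∞ f) (hpos : ∀ p, 0 < f p) (p : B) (x : F)
    (v : TangentSpace IF x) :
    normSq (warpedMetric gB gF f hf hpos) (p, x) (verticalLift p x v) =
      f p ^ 2 * normSq gF x v := by
  change warpedForm gB gF f (p, x) _ _ = _
  rw [warpedForm_apply, verticalLift, mfderiv_prod_right, mfderiv_fst, mfderiv_snd]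
  change gB.inner p (0 : TangentSpace IB p) (0 : TangentSpace IB p) + f p ^ 2 * gF.inner x v v = _
  rw [map_zero, zero_add, normSq]

end WarpedCharts

/-! ### Ricci tensor, Hessian of the weight and Bakry–Émery tensor of the warped product. -/

section WarpedTensors

variable {E : Type*} [NormedAddCommGroup E] [NormedSpace ℝ E]
  {H : Type*} [TopologicalSpace H] {I : ModelWithCorners ℝ E H}
  {M : Type*} [TopologicalSpace M] [ChartedSpace H M] [IsManifold I ∞ M]

theorem ricci_zero (g : RiemMetric I M) (p : M) : ricci g p 0 = 0 := by
  have h : curvatureEndo (metricInChart g p) (extChartAt I p p) 0 0 = 0 := by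
    ext u
    simp [curvatureEndo_apply]
  change LinearMap.trace ℝ E
    (curvatureEndo (metricInChart g p) (extChartAt I p p) 0 0 : E →ₗ[ℝ] E) = 0
  rw [h]
  exact map_zero _

theorem hessian_zero (g : RiemMetric I M) (h : M → ℝ) (p : M) : hessian g h p 0 = 0 :=
  map_zero (hessianCoord (metricInChart g p) (h ∘ (extChartAt I p).symm) (extChartAt I p p) 0)

theorem normSq_zero (g : RiemMetric I M) (p : M) : normSq g p 0 = 0 := map_zero (g.inner p 0)

theorem normSq_eq_metricInChart [I.Boundaryless] (g : RiemMetric I M) (p : M)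
    (v : TangentSpace I p) :
    normSq g p v = metricInChart g p (extChartAt I p p) v v :=
  (metricInChart_self g p v v).symm

theorem weightedRicci_zero_weight {N : ℝ} (g : RiemMetric I M) (p : M) (v : TangentSpace I p)
    (hN : Module.finrank ℝ E ≤ N) :
    weightedRicci N g (fun _ ↦ 0) p v = (ricci g p v : EReal) := by
  have hd : mvfderiv I (fun _ : M ↦ (0 : ℝ)) p v = 0 := by
    rw [mvfderiv_const]; rfl
  have h0 : fderiv ℝ (fun _ : E ↦ (0 : ℝ)) = fun _ ↦ 0 := funext fun y ↦ by simp
  have hh : hessian g (fun _ ↦ 0) p v = 0 := by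
    refine (hessianCoord_apply (metricInChart g p) (fun _ ↦ 0) (extChartAt I p p) v v).trans ?_
    rw [h0, fderiv_fun_const]
    exact sub_zero _
  rw [weightedRicci, hd, hh]
  rcases hN.lt_or_eq with h | h
  · simp [h]
  · simp [h]

section

variable {EB : Type*} [NormedAddCommGroup EB] [NormedSpace ℝ EB]
  {HB : Type*} [TopologicalSpace HB] {IB : ModelWithCorners ℝ EB HB}
  {B : Type*} [TopologicalSpace B] [ChartedSpace HB B]
  {EF : Type*} [NormedAddCommGroup EF] [NormedSpace ℝ EF]
  {HF : Type*} [TopologicalSpace HF] {IF : ModelWithCorners ℝ EF HF}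
  {F : Type*} [TopologicalSpace F] [ChartedSpace HF F]

theorem contMDiff_totalWeight (f : B → ℝ) (hf : ContMDiff IB 𝓘(ℝ, ℝ) ∞ f) (hpos : ∀ p, 0 < f p)
    (Ψ : F → ℝ) (hΨ : ContMDiff IF 𝓘(ℝ, ℝ) ∞ Ψ) (N : ℝ) :
    ContMDiff (IB.prod IF) 𝓘(ℝ, ℝ) ∞ (totalWeight EF N f Ψ) := by
  have hlog : ContMDiff IB 𝓘(ℝ, ℝ) ∞ (fun p ↦ Real.log (f p)) := fun p ↦
    (Real.contDiffAt_log.2 (hpos p).ne').contMDiffAt.comp p (hf p)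
  have h1 : ContMDiff IB 𝓘(ℝ, ℝ) ∞ (warpWeight EF N f) := contMDiff_const.mul hlog
  exact (h1.comp contMDiff_fst).add (hΨ.comp contMDiff_snd)

theorem mvfderiv_totalWeight [IB.Boundaryless] [IsManifold IB ∞ B] [IF.Boundaryless]
    [IsManifold IF ∞ F] (f : B → ℝ) (hf : ContMDiff IB 𝓘(ℝ, ℝ) ∞ f) (hpos : ∀ p, 0 < f p)
    (Ψ : F → ℝ) (hΨ : ContMDiff IF 𝓘(ℝ, ℝ) ∞ Ψ) (N : ℝ) (p : B) (x : F)
    (ξ : TangentSpace IB p) (v : TangentSpace IF x) :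
    mvfderiv (IB.prod IF) (totalWeight EF N f Ψ) (p, x)
        (horizontalLift p x ξ + verticalLift p x v) =
      -(N - Module.finrank ℝ EF) * (mvfderiv IB f p ξ / f p) + mvfderiv IF Ψ x v := by
  have hfp : (f ∘ (extChartAt IB p).symm) (extChartAt IB p p) = f p :=
    congrArg f (extChartAt_to_inv p)
  have hf0' : (f ∘ (extChartAt IB p).symm) (extChartAt IB p p) ≠ 0 := by
    rw [hfp]; exact (hpos p).ne'
  have hφ := contDiffAt_comp_extChartAt_symm hf p
  have hα : ContDiffAt ℝ 2 (fun y ↦ -(N - Module.finrank ℝ EF) *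
      Real.log ((f ∘ (extChartAt IB p).symm) y)) (extChartAt IB p p) :=
    contDiffAt_const.mul (hφ.log hf0')
  have h (ξ : EB) (v : EF) := congrArg (fun L : EB × EF →L[ℝ] ℝ ↦ L (ξ, v))
    (hasFDerivAt_sum_pullbacks (z := (extChartAt IB p p, extChartAt IF x x))
      (hα.differentiableAt (by norm_num))
      ((contDiffAt_comp_extChartAt_symm hΨ x).differentiableAt (by norm_num))).fderiv
  simp only [fderiv_const_mul_log _ (hφ.differentiableAt (by norm_num)) hf0', hfp, add_apply,
    ContinuousLinearMap.comp_apply, ContinuousLinearMap.coe_fst', ContinuousLinearMap.coe_snd',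
    smul_apply, smul_eq_mul] at h
  rw [mvfderiv_apply_eq_fderiv
      ((contMDiff_totalWeight f hf hpos Ψ hΨ N (p, x)).mdifferentiableAt (by simp)),
    mvfderiv_apply_eq_fderiv ((hf p).mdifferentiableAt (by simp)),
    mvfderiv_apply_eq_fderiv ((hΨ x).mdifferentiableAt (by simp)), horizontalLift_add_verticalLift]
  refine (h ξ v).trans ?_
  ring

end

variable {EB : Type*} [NormedAddCommGroup EB] [NormedSpace ℝ EB] [FiniteDimensional ℝ EB]
  {HB : Type*} [TopologicalSpace HB] {IB : ModelWithCorners ℝ EB HB} [IB.Boundaryless]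
  {B : Type*} [TopologicalSpace B] [ChartedSpace HB B] [IsManifold IB ∞ B]
  {EF : Type*} [NormedAddCommGroup EF] [NormedSpace ℝ EF] [FiniteDimensional ℝ EF]
  {HF : Type*} [TopologicalSpace HF] {IF : ModelWithCorners ℝ EF HF} [IF.Boundaryless]
  {F : Type*} [TopologicalSpace F] [ChartedSpace HF F] [IsManifold IF ∞ F]

/-- The Ricci curvature of a warped product. -/
theorem ricci_warpedMetric (gB : RiemMetric IB B) (gF : RiemMetric IF F) (f : B → ℝ)
    (hf : ContMDiff IB 𝓘(ℝ, ℝ) ∞ f) (hpos : ∀ p, 0 < f p) (p : B) (x : F)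
    (ξ : TangentSpace IB p) (v : TangentSpace IF x) :
    ricci (warpedMetric gB gF f hf hpos) (p, x) (horizontalLift p x ξ + verticalLift p x v) =
      ricci gB p ξ - Module.finrank ℝ EF * (hessian gB f p ξ / f p) + ricci gF x v
        - (f p * laplacian gB f p
            + (Module.finrank ℝ EF - 1) * normSq gB p (metricGradient gB f p)) * normSq gF x v := by
  have hfp : (f ∘ (extChartAt IB p).symm) (extChartAt IB p p) = f p :=
    congrArg f (extChartAt_to_inv p)
  have h (ξ : EB) (v : EF) := ricciCoord_warpedCoord (z := (extChartAt IB p p, extChartAt IF x x))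
    (isMetricAt_metricInChart gB p) (isMetricAt_metricInChart gF x)
    (contDiffAt_comp_extChartAt_symm hf p) (by rw [hfp]; exact (hpos p).ne') (ξ, v)
  simp only [hfp] at h
  rw [horizontalLift_add_verticalLift, normSq_eq_metricInChart gF,
    normSq_metricGradient gB ((hf p).mdifferentiableAt (by simp))]
  exact (ricciCoord_congr (metricInChart_warpedMetric gB gF f hf hpos p x) _ _).trans (h ξ v)

theorem hessian_warpedMetric_totalWeight (gB : RiemMetric IB B) (gF : RiemMetric IF F) (f : B → ℝ)
    (hf : ContMDiff IB 𝓘(ℝ, ℝ) ∞ f) (hpos : ∀ p, 0 < f p)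
    (Ψ : F → ℝ) (hΨ : ContMDiff IF 𝓘(ℝ, ℝ) ∞ Ψ) (N : ℝ) (p : B) (x : F)
    (ξ : TangentSpace IB p) (v : TangentSpace IF x) :
    hessian (warpedMetric gB gF f hf hpos) (totalWeight EF N f Ψ) (p, x)
        (horizontalLift p x ξ + verticalLift p x v) =
      -(N - Module.finrank ℝ EF) * (hessian gB f p ξ / f p - (mvfderiv IB f p ξ / f p) ^ 2)
        + hessian gF Ψ x v
        - (N - Module.finrank ℝ EF) * normSq gB p (metricGradient gB f p) * normSq gF x v
        - 2 * (mvfderiv IB f p ξ / f p) * mvfderiv IF Ψ x v := by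
  have hfp : (f ∘ (extChartAt IB p).symm) (extChartAt IB p p) = f p :=
    congrArg f (extChartAt_to_inv p)
  have hf0 : f p ≠ 0 := (hpos p).ne'
  have hf0' : (f ∘ (extChartAt IB p).symm) (extChartAt IB p p) ≠ 0 := by rwa [hfp]
  have hφ := contDiffAt_comp_extChartAt_symm hf p
  have hα : ContDiffAt ℝ 2 (fun y ↦ -(N - Module.finrank ℝ EF) *
      Real.log ((f ∘ (extChartAt IB p).symm) y)) (extChartAt IB p p) :=
    contDiffAt_const.mul (hφ.log hf0')
  have h (ξ : EB) (v : EF) := hessianCoord_warpedCoord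
    (z := (extChartAt IB p p, extChartAt IF x x))
    (isMetricAt_metricInChart gB p) (isMetricAt_metricInChart gF x) hφ hf0' hα
    (contDiffAt_comp_extChartAt_symm hΨ x) (ξ, v)
  simp only [hessianCoord_const_mul_log _ hφ hf0', fderiv_const_mul_log _
    (hφ.differentiableAt (by norm_num)) hf0', hfp, smul_apply, smul_eq_mul] at h
  have hcongr := hessianCoord_congr (metricInChart_warpedMetric gB gF f hf hpos p x)
    (Filter.EventuallyEq.refl _ (totalWeight EF N f Ψ ∘ (extChartAt (IB.prod IF) (p, x)).symm))
  rw [horizontalLift_add_verticalLift, normSq_eq_metricInChart gF,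
    normSq_metricGradient gB ((hf p).mdifferentiableAt (by simp)),
    mvfderiv_apply_eq_fderiv ((hf p).mdifferentiableAt (by simp)),
    mvfderiv_apply_eq_fderiv ((hΨ x).mdifferentiableAt (by simp))]
  refine (congrArg (fun L : EB × EF →L[ℝ] EB × EF →L[ℝ] ℝ ↦ L (ξ, v) (ξ, v)) hcongr).trans
    ((h ξ v).trans ?_)
  unfold hessian
  field_simp
  ring

/-- The Bakry–Émery Ricci tensor of an `N`-warped product. -/
theorem weightedRicci_warpedMetric (gB : RiemMetric IB B) (gF : RiemMetric IF F) (f : B → ℝ)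
    (hf : ContMDiff IB 𝓘(ℝ, ℝ) ∞ f) (hpos : ∀ p, 0 < f p)
    (Ψ : F → ℝ) (hΨ : ContMDiff IF 𝓘(ℝ, ℝ) ∞ Ψ) (N : ℝ) (p : B) (x : F)
    (ξ : TangentSpace IB p) (v : TangentSpace IF x)
    (h0 : N < Module.finrank ℝ EF → v = 0 → ξ = 0) :
    weightedRicci (N + Module.finrank ℝ EB) (warpedMetric gB gF f hf hpos)
        (totalWeight EF N f Ψ) (p, x) (horizontalLift p x ξ + verticalLift p x v) =
      ((ricci gB p ξ - N * (hessian gB f p ξ / f p) : ℝ) : EReal)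
        + weightedRicci N gF Ψ x v
        - (((laplacian gB f p / f p
              + (N - 1) * (normSq gB p (metricGradient gB f p) / f p ^ 2))
            * normSq (warpedMetric gB gF f hf hpos) (p, x) (verticalLift p x v) : ℝ) : EReal) := by
  have hf0 : f p ≠ 0 := (hpos p).ne'
  have hdim : (Module.finrank ℝ (EB × EF) : ℝ) = Module.finrank ℝ EB + Module.finrank ℝ EF := by
    rw [Module.finrank_prod, Nat.cast_add]
  rw [normSq_verticalLift]
  unfold weightedRicci
  rw [ricci_warpedMetric, hessian_warpedMetric_totalWeight gB gF f hf hpos Ψ hΨ,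
    mvfderiv_totalWeight f hf hpos Ψ hΨ, hdim]
  rcases lt_trichotomy (Module.finrank ℝ EF : ℝ) N with h | h | h
  -- Case `N > n`. The excess of `N + d` over the dimension of the product is again `N - n`, so the
  -- square in the total differential cancels the terms in `df(ξ)/f`.
  · have hne : N - Module.finrank ℝ EF ≠ 0 := (sub_pos.2 h).ne'
    have hne' : N + Module.finrank ℝ EB - (Module.finrank ℝ EB + Module.finrank ℝ EF) =
      N - Module.finrank ℝ EF := by ring
    rw [if_pos (by linarith), if_pos h, ← EReal.coe_add, ← EReal.coe_sub, EReal.coe_eq_coe_iff,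
      hne']
    field_simp
    ring
  -- Case `N = n`. The base weight vanishes, so both sides test the same condition `dΨ(v) = 0`; a
  -- value `-∞` is unaffected by the remaining real terms.
  · have hz : N - Module.finrank ℝ EF = 0 := by linarith
    have h1 : ¬ (Module.finrank ℝ EB + Module.finrank ℝ EF : ℝ) < N + Module.finrank ℝ EB := by
      linarith
    have h2 : N + Module.finrank ℝ EB = Module.finrank ℝ EB + Module.finrank ℝ EF := by linarith
    rw [if_neg h1, if_pos h2, if_neg h.not_lt, if_pos h.symm]
    simp only [hz, neg_zero, zero_mul, zero_add, sub_zero]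
    by_cases hv : mvfderiv IF Ψ x v = 0
    · rw [if_pos hv, if_pos hv, hv, ← EReal.coe_add, ← EReal.coe_sub, EReal.coe_eq_coe_iff, h]
      field_simp
      ring
    · rw [if_neg hv, if_neg hv, EReal.add_bot, EReal.bot_sub]
  -- Case `N < n`. The left side is finite only if `ξ` and `v` both vanish, the right side as soon
  -- as `v = 0`; `h0` excludes the discrepancy `v = 0`, `ξ ≠ 0`.
  · have h1 : ¬ (Module.finrank ℝ EB + Module.finrank ℝ EF : ℝ) < N + Module.finrank ℝ EB := by
      linarith
    have h2 : N + Module.finrank ℝ EB ≠ Module.finrank ℝ EB + Module.finrank ℝ EF := by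
      intro h'
      linarith
    rw [if_neg h1, if_neg h2, if_neg h.not_gt, if_neg h.ne, horizontalLift_add_verticalLift]
    by_cases hv : v = 0
    · rw [if_pos hv, if_pos (by rw [h0 h hv, hv]; rfl), h0 h hv, hv, ricci_zero, hessian_zero,
        normSq_zero]
      simp
    · rw [if_neg hv, if_neg, EReal.add_bot, EReal.bot_sub]
      exact fun h' ↦ hv (congrArg Prod.snd (h' : ((ξ, v) : EB × EF) = 0))

end WarpedTensors

end WarpedRicci

end

/-! ### The final statement. -/

theorem mainTheorem4
    {EB : Type*} [NormedAddCommGroup EB] [NormedSpace ℝ EB] [FiniteDimensional ℝ EB]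
    {HB : Type*} [TopologicalSpace HB] {IB : ModelWithCorners ℝ EB HB} [IB.Boundaryless]
    {B : Type*} [TopologicalSpace B] [ChartedSpace HB B] [IsManifold IB ∞ B]
    {EF : Type*} [NormedAddCommGroup EF] [NormedSpace ℝ EF] [FiniteDimensional ℝ EF]
    {HF : Type*} [TopologicalSpace HF] {IF : ModelWithCorners ℝ EF HF} [IF.Boundaryless]
    {F : Type*} [TopologicalSpace F] [ChartedSpace HF F] [IsManifold IF ∞ F]
    (gB : RiemMetric IB B) (gF : RiemMetric IF F)
    (f : B → ℝ) (hf : ContMDiff IB 𝓘(ℝ, ℝ) ∞ f) (hpos : ∀ p, 0 < f p)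
    (Ψ : F → ℝ) (hΨ : ContMDiff IF 𝓘(ℝ, ℝ) ∞ Ψ)
    (N : ℝ) (hN : 1 ≤ N)
    (p : B) (x : F) (ξ : TangentSpace IB p) (v : TangentSpace IF x) :
    ((N < Module.finrank ℝ EF → v = 0 → ξ = 0) →
      weightedRicci (N + Module.finrank ℝ EB) (warpedMetric gB gF f hf hpos)
          (totalWeight EF N f Ψ) (p, x) (horizontalLift p x ξ + verticalLift p x v) =
        ((ricci gB p ξ - N * (hessian gB f p ξ / f p) : ℝ) : EReal)
          + weightedRicci N gF Ψ x v
          - (((laplacian gB f p / f p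
                + (N - 1) * (normSq gB p (metricGradient gB f p) / f p ^ 2))
              * normSq (warpedMetric gB gF f hf hpos) (p, x) (verticalLift p x v) : ℝ) : EReal))
    ∧ (Module.finrank ℝ EF ≤ N →
        weightedRicci N gF (fun _ ↦ 0) x v = (ricci gF x v : EReal)
        ∧ weightedRicci (N + Module.finrank ℝ EB) (warpedMetric gB gF f hf hpos)
            (totalWeight EF N f (fun _ : F ↦ 0)) (p, x)
            (horizontalLift p x ξ + verticalLift p x v) =
          ((ricci gB p ξ - N * (hessian gB f p ξ / f p) + ricci gF x v
            - (laplacian gB f p / f p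
                + (N - 1) * (normSq gB p (metricGradient gB f p) / f p ^ 2))
              * normSq (warpedMetric gB gF f hf hpos) (p, x) (verticalLift p x v) : ℝ) : EReal))
    ∧ normSq (warpedMetric gB gF f hf hpos) (p, x) (verticalLift p x v)
        = f p ^ 2 * normSq gF x v := by
  refine ⟨weightedRicci_warpedMetric gB gF f hf hpos Ψ hΨ N p x ξ v, fun h ↦
    ⟨weightedRicci_zero_weight gF x v h, ?_⟩, normSq_verticalLift gB gF f hf hpos p x v⟩
  -- Part (ii) is part (i) with zero weight on the fibre; its side condition is vacuous because `n ≤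
  -- N`.
  rw [weightedRicci_warpedMetric gB gF f hf hpos (fun _ ↦ 0) contMDiff_const N p x ξ v
    (fun h' ↦ absurd h' h.not_gt), weightedRicci_zero_weight gF x v h, ← EReal.coe_add,
    ← EReal.coe_sub]
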